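/- Let $k$ be a field. A (right) Leibniz algebra over $k$ is a $k$-vector space with a bilinear product satisfying $x(yz)=(xy)z-(xz)y$; it is metabelian if it has an ideal $I$ such that both $I$ and the quotient by $I$ have zero multiplication. Let $X$ be a well-ordered set (of any cardinality), let $\mathrm{Lb}(X)$ be the free Leibniz algebra over $k$ generated by $X$, i.e. the quotient of the free non-associative algebra on $X$ by the ideal generated by all $x(yz)-(xy)z+(xz)y$, and write $[f_1f_2\cdots f_n]=((\cdots((f_1f_2)f_3)\cdots)f_n)$. The elements $[a_1\cdots a_n]$ with $n\ge 1$, $a_i\in X$, form a linear basis $\mathrm{NF}(X)$ of $\mathrm{Lb}(X)$. Order $\mathrm{NF}(X)$ first by length $n$ and then lexicographically by $(a_1,\dots,a_n)$ (the deg-length-lex order in which every letter has degree $1$). For $0\ne f\in\mathrm{Lb}(X)$ let $\bar f$ be the largest element of $\mathrm{NF}(X)$ in the support of $f$; $f$ is monic if the coefficient of $\bar f$ is $1$. For a set $S$ of monic elements, the normal $S$-polynomials are the elements $h_s=[s a_1\cdots a_m]$ ($s\in S$, $m\ge 0$, $a_i\in X$) and, when $\bar s$ has length $1$, $h_s=[a_1\cdots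 a_t\, s\, a_{t+1}\cdots a_m]$ ($1\le t\le m$). The set $S$ is a Gröbner–Shirshov basis in $\mathrm{Lb}(X)$ if (i) whenever $f,g\in S$, $f\neq g$, and $\bar f=\overline{h_g}$ for a normal $S$-polynomial $h_g$ formed from $g$, the element $f-h_g$ is a linear combination of normal $S$-polynomials with leading monomials $<\bar f$; and (ii) whenever $f\in S$, $\bar f$ has length $>1$, $\mu\in\mathrm{NF}(X)$ and $\mu f\ne 0$, the element $\mu f$ is a linear combination of normal $S$-polynomials whose leading monomials have degree at most $\deg\mu+\deg\bar f$. Let $\mathrm{MLb}(X)$ be the quotient of $\mathrm{Lb}(X)$ by the ideal generated by all products $(xy)(zt)$. Then $\mathrm{MLb}(X)$, with the canonical map $X\to\mathrm{MLb}(X)$, is the free metabelian Leibniz algebra generated by $X$: it is a metabelian Leibniz algebra, and every map from $X$ to a metabelian Leibniz algebra over $k$ extends uniquely to an algebra homomorphism from $\mathrm{MLb}(X)$. The set $$S_1=\{[c_1\cdots c_p a_1a_2]-[c_1\cdots c_p a_2a_1]\;:\;p\ge 2,\ c_1,\dots,c_p,a_1,a_2\in X,\ a_2<a_1\}$$ is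 a Gröbner–Shirshov basis in $\mathrm{Lb}(X)$, and the ideal it generates is the kernel of $\mathrm{Lb}(X)\to\mathrm{MLb}(X)$, so that $\mathrm{MLb}(X)=\mathrm{Lb}(X\mid S_1)$. Moreover, the elements $$[a_1a_2\cdots a_n],\qquad n\ge 1,\ a_1,\dots,a_n\in X,\ a_3\le a_4\le\cdots\le a_n,$$ are pairwise distinct and form a linear basis of $\mathrm{MLb}(X)$. -/

import Mathlib

universe u v w

/-! ## Non-associative algebras, ideals, quotients -/

section Algebras

variable (k : Type u) [CommRing k]

/-- A two-sided ideal of a non-associative algebra: a linear subspace that is closed under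
multiplication by arbitrary elements of the algebra on either side. -/
structure AlgIdeal (A : Type v) [NonUnitalNonAssocRing A] [Module k A] extends
    Submodule k A where
  mul_mem_left' : ∀ (a : A) {b : A}, b ∈ carrier → a * b ∈ carrier
  mul_mem_right' : ∀ (a : A) {b : A}, b ∈ carrier → b * a ∈ carrier

namespace AlgIdeal

variable {k} {A : Type v} [NonUnitalNonAssocRing A] [Module k A]

variable (k) in
/-- `Id(S)`: the ideal generated by a set `S`, i.e. the smallest ideal containing `S`. -/
def span (S : Set A) : AlgIdeal k A where
  toSubmodule := sInf {J : Submodule k A | S ⊆ J ∧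
    (∀ a b : A, b ∈ J → a * b ∈ J) ∧ (∀ a b : A, b ∈ J → b * a ∈ J)}
  mul_mem_left' a b hb := by
    have hb' := Submodule.mem_sInf.1 hb
    exact Submodule.mem_sInf.2 fun J hJ => hJ.2.1 a b (hb' J hJ)
  mul_mem_right' a b hb := by
    have hb' := Submodule.mem_sInf.1 hb
    exact Submodule.mem_sInf.2 fun J hJ => hJ.2.2 a b (hb' J hJ)

theorem subset_span (S : Set A) : S ⊆ (span k S).toSubmodule := fun _ hs =>
  Submodule.mem_sInf.2 fun _ hJ => hJ.1 hs

theorem span_le {S : Set A} {J : Submodule k A} (hS : S ⊆ J)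
    (hl : ∀ a b : A, b ∈ J → a * b ∈ J) (hr : ∀ a b : A, b ∈ J → b * a ∈ J) :
    (span k S).toSubmodule ≤ J := sInf_le ⟨hS, hl, hr⟩

/-- The quotient algebra `A / I`. -/
def Quot (I : AlgIdeal k A) : Type v := A ⧸ I.toSubmodule

namespace Quot

variable (I : AlgIdeal k A)

instance : AddCommGroup I.Quot := inferInstanceAs (AddCommGroup (A ⧸ I.toSubmodule))

instance : Module k I.Quot := inferInstanceAs (Module k (A ⧸ I.toSubmodule))

/-- The canonical projection `A → A / I`, as a linear map. -/
def mk : A →ₗ[k] I.Quot := I.toSubmodule.mkQ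

theorem mk_surjective : Function.Surjective (mk I) := Submodule.mkQ_surjective _

theorem mk_eq_mk {a b : A} : mk I a = mk I b ↔ a - b ∈ I.toSubmodule :=
  Submodule.Quotient.eq _

instance : Mul I.Quot :=
  ⟨Quotient.map₂ (· * ·) (by
    intro a a' ha b b' hb
    have ha' : a - a' ∈ I.toSubmodule := (Submodule.quotientRel_def _).1 ha
    have hb' : b - b' ∈ I.toSubmodule := (Submodule.quotientRel_def _).1 hb
    refine (Submodule.quotientRel_def _).2 ?_
    have h1 : (a - a') * b ∈ I.toSubmodule := I.mul_mem_right' b ha'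
    have h2 : a' * (b - b') ∈ I.toSubmodule := I.mul_mem_left' a' hb'
    have h3 := add_mem h1 h2
    rwa [sub_mul, mul_sub, sub_add_sub_cancel] at h3)⟩

theorem mk_mul (a b : A) : mk I (a * b) = mk I a * mk I b := rfl

instance : NonUnitalNonAssocRing I.Quot where
  __ := (inferInstance : AddCommGroup I.Quot)
  __ := (inferInstance : Mul I.Quot)
  left_distrib a b c := by
    obtain ⟨a, rfl⟩ := mk_surjective I a
    obtain ⟨b, rfl⟩ := mk_surjective I b
    obtain ⟨c, rfl⟩ := mk_surjective I c
    simp only [← map_add, ← mk_mul, mul_add]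
  right_distrib a b c := by
    obtain ⟨a, rfl⟩ := mk_surjective I a
    obtain ⟨b, rfl⟩ := mk_surjective I b
    obtain ⟨c, rfl⟩ := mk_surjective I c
    simp only [← map_add, ← mk_mul, add_mul]
  zero_mul a := by
    obtain ⟨a, rfl⟩ := mk_surjective I a
    rw [← map_zero (mk I), ← mk_mul, zero_mul]
  mul_zero a := by
    obtain ⟨a, rfl⟩ := mk_surjective I a
    rw [← map_zero (mk I), ← mk_mul, mul_zero]

instance [IsScalarTower k A A] : IsScalarTower k I.Quot I.Quot where
  smul_assoc r a b := by
    obtain ⟨a, rfl⟩ := mk_surjective I a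
    obtain ⟨b, rfl⟩ := mk_surjective I b
    simp only [smul_eq_mul, ← map_smul, ← mk_mul, smul_mul_assoc]

instance [SMulCommClass k A A] : SMulCommClass k I.Quot I.Quot where
  smul_comm r a b := by
    obtain ⟨a, rfl⟩ := mk_surjective I a
    obtain ⟨b, rfl⟩ := mk_surjective I b
    simp only [smul_eq_mul, ← map_smul, ← mk_mul, mul_smul_comm]

end Quot

end AlgIdeal

/-- A (right) Leibniz algebra: `x(yz) = (xy)z - (xz)y`. -/
class IsLeibniz (A : Type v) [NonUnitalNonAssocRing A] : Prop where
  leibniz : ∀ x y z : A, x * (y * z) = (x * y) * z - (x * z) * y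

instance {k : Type u} [CommRing k] {A : Type v} [NonUnitalNonAssocRing A] [Module k A]
    [IsLeibniz A] (I : AlgIdeal k A) : IsLeibniz I.Quot where
  leibniz x y z := by
    obtain ⟨x, rfl⟩ := AlgIdeal.Quot.mk_surjective I x
    obtain ⟨y, rfl⟩ := AlgIdeal.Quot.mk_surjective I y
    obtain ⟨z, rfl⟩ := AlgIdeal.Quot.mk_surjective I z
    simp only [← AlgIdeal.Quot.mk_mul, ← map_sub, IsLeibniz.leibniz x y z]

/-- An algebra is metabelian if it is an extension of an abelian algebra by an abelian algebra:
it has an ideal `I` with zero multiplication such that `A / I` has zero multiplication. -/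
def IsMetabelian (A : Type v) [NonUnitalNonAssocRing A] [Module k A] : Prop :=
  ∃ I : AlgIdeal k A, (∀ x ∈ I.toSubmodule, ∀ y ∈ I.toSubmodule, x * y = 0) ∧
    ∀ x y : I.Quot, x * y = 0

/-- `[x f₁ ⋯ fₙ] = ((⋯((x f₁) f₂)⋯) fₙ)`, left-normed bracketing. -/
def leftNormed {A : Type v} [Mul A] (x : A) (l : List A) : A := l.foldl (· * ·) x

end Algebras

/-- `i : X → M` exhibits `M` as a free metabelian Leibniz algebra on `X` over `k`:
`M` is a metabelian Leibniz algebra, and every map from `X` to a metabelian Leibniz algebra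
(in the universe `w`) extends uniquely along `i` to a homomorphism of algebras. -/
def IsFreeMetabelianLeibniz.{u₁, v₁, m₁, w₁} (k : Type u₁) [Field k] {X : Type v₁} {M : Type m₁}
    [NonUnitalNonAssocRing M] [Module k M] (i : X → M) : Prop :=
  IsLeibniz M ∧ IsMetabelian k M ∧
    ∀ (A : Type w₁) [NonUnitalNonAssocRing A] [Module k A] [IsScalarTower k A A]
      [SMulCommClass k A A] [IsLeibniz A], IsMetabelian k A →
      ∀ φ : X → A, ∃! Φ : M →ₙₐ[k] A, ∀ x, Φ (i x) = φ x

/-! ## The free Leibniz algebra -/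

section FreeLeibniz

variable (k : Type u) [Field k] (X : Type v)

/-- The ideal of the free non-associative algebra generated by all
`x(yz) - (xy)z + (xz)y`. -/
noncomputable def leibnizIdeal : AlgIdeal k (FreeNonUnitalNonAssocAlgebra k X) :=
  AlgIdeal.span k {f | ∃ x y z, f = x * (y * z) - (x * y) * z + (x * z) * y}

/-- `Lb(X)`: the free Leibniz algebra generated by `X`. -/
noncomputable abbrev Lb : Type (max u v) := (leibnizIdeal k X).Quot

instance : IsLeibniz (Lb k X) where
  leibniz x y z := by
    obtain ⟨x, rfl⟩ := AlgIdeal.Quot.mk_surjective _ x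
    obtain ⟨y, rfl⟩ := AlgIdeal.Quot.mk_surjective _ y
    obtain ⟨z, rfl⟩ := AlgIdeal.Quot.mk_surjective _ z
    simp only [← AlgIdeal.Quot.mk_mul, ← map_sub]
    rw [AlgIdeal.Quot.mk_eq_mk]
    refine AlgIdeal.subset_span _ ⟨x, y, z, ?_⟩
    abel

variable {X}

/-- The generator of `Lb(X)` given by a letter. -/
noncomputable def Lb.of (a : X) : Lb k X :=
  AlgIdeal.Quot.mk (leibnizIdeal k X) (FreeNonUnitalNonAssocAlgebra.of k a)

/-- The element `[a₁ a₂ ⋯ aₙ]` of `Lb(X)` given by a nonempty word `a₁ a₂ ⋯ aₙ`. -/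
noncomputable def Lb.nf (u : FreeSemigroup X) : Lb k X :=
  leftNormed (Lb.of k u.head) (u.tail.map (Lb.of k))

end FreeLeibniz

/-! ## The left-normed words are a linear basis of the free Leibniz algebra -/

section NormalForm

variable (k : Type u) [Field k] (X : Type v)

/-- Auxiliary model of the free Leibniz algebra: the vector space on all nonempty words. -/
def WordAlg : Type (max u v) := FreeSemigroup X →₀ k

namespace WordAlg

noncomputable instance : AddCommGroup (WordAlg k X) :=
  inferInstanceAs (AddCommGroup (FreeSemigroup X →₀ k))

noncomputable instance : Module k (WordAlg k X) :=
  inferInstanceAs (Module k (FreeSemigroup X →₀ k))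

variable {X}

/-- The basis vector of a word. -/
noncomputable def word (u : FreeSemigroup X) : WordAlg k X := Finsupp.single u (1 : k)

/-- Appending a letter. -/
noncomputable def app (a : X) : Module.End k (WordAlg k X) :=
  Finsupp.lmapDomain k k (fun u : FreeSemigroup X => u * FreeSemigroup.of a)

/-- Right multiplication by a word. -/
noncomputable def rmulWord (u : FreeSemigroup X) : Module.End k (WordAlg k X) :=
  u.tail.foldl (fun T a => ⁅app k a, T⁆) (app k u.head)

/-- Right multiplication by an arbitrary element. -/
noncomputable def rmul : WordAlg k X →ₗ[k] Module.End k (WordAlg k X) :=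
  Finsupp.linearCombination k (rmulWord k)

variable {k}

theorem app_word (a : X) (u : FreeSemigroup X) :
    app k a (word k u) = word k (u * FreeSemigroup.of a) := Finsupp.mapDomain_single

theorem rmul_word (u : FreeSemigroup X) : rmul k (word k u) = rmulWord k u := by
  have h := Finsupp.linearCombination_single (R := k) (v := rmulWord k) (1 : k) u
  rw [one_smul] at h
  exact h

theorem rmulWord_of (a : X) : rmulWord k (FreeSemigroup.of a) = app k a := rfl

theorem rmulWord_mul_of (u : FreeSemigroup X) (a : X) :
    rmulWord k (u * FreeSemigroup.of a) = ⁅app k a, rmulWord k u⁆ := by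
  show List.foldl _ _ (u.tail ++ [a]) = _
  rw [List.foldl_append]
  rfl

theorem ind {p : WordAlg k X → Prop} (f : WordAlg k X) (h0 : p 0)
    (ha : ∀ f g, p f → p g → p (f + g)) (hs : ∀ (c : k) (u : FreeSemigroup X), p (c • word k u)) :
    p f := by
  refine Finsupp.induction_linear f h0 ha fun u c => ?_
  have h := hs c u
  have e : c • word k u = (Finsupp.single u c : FreeSemigroup X →₀ k) := by
    show c • (Finsupp.single u (1 : k) : FreeSemigroup X →₀ k) = _
    simp
  rwa [e] at h

theorem rmul_app (f : WordAlg k X) (a : X) : rmul k (app k a f) = ⁅app k a, rmul k f⁆ := by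
  induction f using ind with
  | h0 => simp [Ring.lie_def]
  | ha f g hf hg =>
    rw [map_add, map_add, map_add, hf, hg]
    simp only [Ring.lie_def]
    noncomm_ring
  | hs c u => simp [app_word, rmul_word, rmulWord_mul_of, Ring.lie_def, smul_sub]

theorem _root_.FreeSemigroup.rightInd {X : Type v} {p : FreeSemigroup X → Prop}
    (u : FreeSemigroup X) (h1 : ∀ a, p (FreeSemigroup.of a))
    (h2 : ∀ u a, p u → p (u * FreeSemigroup.of a)) : p u := by
  obtain ⟨a, l⟩ := u
  induction l using List.reverseRecOn with
  | nil => exact h1 a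
  | append_singleton l b ih => exact h2 ⟨a, l⟩ b ih

theorem rmul_rmulWord (u : FreeSemigroup X) :
    ∀ f : WordAlg k X, rmul k (rmulWord k u f) = ⁅rmulWord k u, rmul k f⁆ := by
  induction u using FreeSemigroup.rightInd with
  | h1 a => intro f; exact rmul_app f a
  | h2 u a ih =>
    intro f
    rw [rmulWord_mul_of]
    have e : ⁅app k a, rmulWord k u⁆ f = app k a (rmulWord k u f) - rmulWord k u (app k a f) := by
      simp [Ring.lie_def]
    rw [e, map_sub, rmul_app, ih, ih, rmul_app]
    simp only [Ring.lie_def]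
    noncomm_ring

noncomputable instance : Mul (WordAlg k X) := ⟨fun f g => rmul k g f⟩

theorem mul_def (f g : WordAlg k X) : f * g = rmul k g f := rfl

noncomputable instance : NonUnitalNonAssocRing (WordAlg k X) where
  __ := (inferInstance : AddCommGroup (WordAlg k X))
  __ := (inferInstance : Mul (WordAlg k X))
  left_distrib f g h := by simp [mul_def]
  right_distrib f g h := by simp [mul_def]
  zero_mul f := by simp [mul_def]
  mul_zero f := by simp [mul_def]

instance : IsScalarTower k (WordAlg k X) (WordAlg k X) where
  smul_assoc r f g := by simp [mul_def]

instance : SMulCommClass k (WordAlg k X) (WordAlg k X) where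
  smul_comm r f g := by simp [mul_def]

theorem rmul_rmul (g f : WordAlg k X) : rmul k (rmul k g f) = ⁅rmul k g, rmul k f⁆ := by
  induction g using ind with
  | h0 => simp [Ring.lie_def]
  | ha g h hg hh =>
    rw [map_add, LinearMap.add_apply, map_add, hg, hh]
    simp only [Ring.lie_def]
    noncomm_ring
  | hs c u => simp [rmul_word, rmul_rmulWord, Ring.lie_def, smul_sub]

instance : IsLeibniz (WordAlg k X) where
  leibniz x y z := by simp [mul_def, rmul_rmul, Ring.lie_def]

end WordAlg

variable {X}

/-- The algebra map from the free non-associative algebra to the model. -/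
noncomputable def toWordAlg : FreeNonUnitalNonAssocAlgebra k X →ₙₐ[k] WordAlg k X :=
  FreeNonUnitalNonAssocAlgebra.lift k fun a => WordAlg.word k (FreeSemigroup.of a)

theorem leibnizIdeal_le_ker :
    (leibnizIdeal k X).toSubmodule ≤
      LinearMap.ker ((toWordAlg k : FreeNonUnitalNonAssocAlgebra k X →ₙₐ[k] WordAlg k X) :
        FreeNonUnitalNonAssocAlgebra k X →ₗ[k] WordAlg k X) := by
  refine AlgIdeal.span_le ?_ ?_ ?_
  · rintro _ ⟨x, y, z, rfl⟩
    simp [IsLeibniz.leibniz (toWordAlg k x)]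
  · intro a b hb
    have hb' : toWordAlg k b = 0 := hb
    simp [hb']
  · intro a b hb
    have hb' : toWordAlg k b = 0 := hb
    simp [hb']

/-- The linear map from the free Leibniz algebra to the model. -/
noncomputable def Lb.toWordAlg : Lb k X →ₗ[k] WordAlg k X :=
  Submodule.liftQ _ _ (leibnizIdeal_le_ker k)

theorem Lb.toWordAlg_of (a : X) :
    Lb.toWordAlg k (Lb.of k a) = WordAlg.word k (FreeSemigroup.of a) :=
  FreeNonUnitalNonAssocAlgebra.lift_of_apply k (fun a : X => WordAlg.word k (FreeSemigroup.of a)) a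

theorem Lb.toWordAlg_mul (x y : Lb k X) :
    Lb.toWordAlg k (x * y) = Lb.toWordAlg k x * Lb.toWordAlg k y := by
  obtain ⟨x, rfl⟩ := AlgIdeal.Quot.mk_surjective _ x
  obtain ⟨y, rfl⟩ := AlgIdeal.Quot.mk_surjective _ y
  exact map_mul (_root_.toWordAlg k) x y

theorem Lb.nf_of (a : X) : Lb.nf k (FreeSemigroup.of a) = Lb.of k a := rfl

theorem Lb.nf_mul_of (u : FreeSemigroup X) (a : X) :
    Lb.nf k (u * FreeSemigroup.of a) = Lb.nf k u * Lb.of k a := by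
  show List.foldl _ _ (List.map _ (u.tail ++ [a])) = _
  rw [List.map_append, List.foldl_append]
  rfl

theorem Lb.toWordAlg_nf (u : FreeSemigroup X) :
    Lb.toWordAlg k (Lb.nf k u) = WordAlg.word k u := by
  induction u using FreeSemigroup.rightInd with
  | h1 a => exact Lb.toWordAlg_of k a
  | h2 u a ih =>
    rw [Lb.nf_mul_of, Lb.toWordAlg_mul, ih, Lb.toWordAlg_of, WordAlg.mul_def, WordAlg.rmul_word,
      WordAlg.rmulWord_of, WordAlg.app_word]

theorem Lb.linearIndependent_nf : LinearIndependent k (Lb.nf k (X := X)) := by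
  refine LinearIndependent.of_comp (Lb.toWordAlg k) ?_
  have e : Lb.toWordAlg k ∘ Lb.nf k (X := X) = WordAlg.word k := funext (Lb.toWordAlg_nf k)
  rw [e]
  exact Finsupp.linearIndependent_single_one k (FreeSemigroup X)

theorem Lb.mul_nf_mem (u : FreeSemigroup X) :
    ∀ f ∈ Submodule.span k (Set.range (Lb.nf k (X := X))),
      f * Lb.nf k u ∈ Submodule.span k (Set.range (Lb.nf k (X := X))) := by
  induction u using FreeSemigroup.rightInd with
  | h1 a =>
    intro f hf
    induction hf using Submodule.span_induction with
    | mem f hf =>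
      obtain ⟨v, rfl⟩ := hf
      rw [Lb.nf_of, ← Lb.nf_mul_of]
      exact Submodule.subset_span ⟨_, rfl⟩
    | zero => simp
    | add f g _ _ hf hg => rw [add_mul]; exact add_mem hf hg
    | smul c f _ hf => rw [smul_mul_assoc]; exact Submodule.smul_mem _ _ hf
  | h2 u a ih =>
    intro f hf
    have ha : ∀ f ∈ Submodule.span k (Set.range (Lb.nf k (X := X))),
        f * Lb.of k a ∈ Submodule.span k (Set.range (Lb.nf k (X := X))) := by
      intro f hf
      induction hf using Submodule.span_induction with
      | mem f hf =>
        obtain ⟨v, rfl⟩ := hf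
        rw [← Lb.nf_mul_of]
        exact Submodule.subset_span ⟨_, rfl⟩
      | zero => simp
      | add f g _ _ hf hg => rw [add_mul]; exact add_mem hf hg
      | smul c f _ hf => rw [smul_mul_assoc]; exact Submodule.smul_mem _ _ hf
    rw [Lb.nf_mul_of, IsLeibniz.leibniz]
    exact sub_mem (ha _ (ih _ hf)) (ih _ (ha _ hf))

theorem Lb.span_nf : ⊤ ≤ Submodule.span k (Set.range (Lb.nf k (X := X))) := by
  rintro f -
  have hmul : ∀ f ∈ Submodule.span k (Set.range (Lb.nf k (X := X))),
      ∀ g ∈ Submodule.span k (Set.range (Lb.nf k (X := X))),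
        f * g ∈ Submodule.span k (Set.range (Lb.nf k (X := X))) := by
    intro f hf g hg
    induction hg using Submodule.span_induction with
    | mem g hg =>
      obtain ⟨v, rfl⟩ := hg
      exact Lb.mul_nf_mem k v f hf
    | zero => simp
    | add g h _ _ hg hh => rw [mul_add]; exact add_mem hg hh
    | smul c g _ hg => rw [mul_smul_comm]; exact Submodule.smul_mem _ _ hg
  obtain ⟨f, rfl⟩ := AlgIdeal.Quot.mk_surjective _ f
  have hterm : ∀ t : FreeMagma X,
      AlgIdeal.Quot.mk (leibnizIdeal k X) (MonoidAlgebra.single t (1 : k)) ∈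
        Submodule.span k (Set.range (Lb.nf k (X := X))) := by
    intro t
    induction t using FreeMagma.recOnMul with
    | ih1 a => exact Submodule.subset_span ⟨FreeSemigroup.of a, rfl⟩
    | ih2 s t hs ht =>
      have h := hmul _ hs _ ht
      rw [← AlgIdeal.Quot.mk_mul] at h
      have e : (MonoidAlgebra.single s (1 : k) * MonoidAlgebra.single t (1 : k) :
          FreeNonUnitalNonAssocAlgebra k X) = MonoidAlgebra.single (s * t) (1 : k) := by
        refine (MonoidAlgebra.single_mul_single _ _ _ _).trans ?_
        rw [one_mul]
      rwa [e] at h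
  refine MonoidAlgebra.induction_linear (motive := fun f : FreeNonUnitalNonAssocAlgebra k X =>
    AlgIdeal.Quot.mk (leibnizIdeal k X) f ∈ Submodule.span k (Set.range (Lb.nf k (X := X)))) f
    ?_ ?_ ?_
  · simp
  · intro f g hf hg
    rw [map_add]
    exact add_mem hf hg
  · intro t c
    have h := Submodule.smul_mem _ c (hterm t)
    rw [← map_smul] at h
    have e : (c • MonoidAlgebra.single t (1 : k) : FreeNonUnitalNonAssocAlgebra k X) =
        MonoidAlgebra.single t c := by
      refine (MonoidAlgebra.smul_single _ _ _).trans ?_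
      rw [smul_eq_mul, mul_one]
    rwa [e] at h

/-- `NF(X)`: the linear basis of `Lb(X)` formed by the elements `[a₁ ⋯ aₙ]`, `n ≥ 1`. -/
noncomputable def Lb.nfBasis : Module.Basis (FreeSemigroup X) k (Lb k X) :=
  Module.Basis.mk (Lb.linearIndependent_nf k) (Lb.span_nf k)

theorem Lb.nfBasis_apply (u : FreeSemigroup X) : Lb.nfBasis k u = Lb.nf k u :=
  Module.Basis.mk_apply _ _ _

end NormalForm

/-! ## Gröbner–Shirshov bases in the free Leibniz algebra -/

section GroebnerShirshov

variable {k : Type u} [Field k] {X : Type v} [LinearOrder X] (deg : X → ℕ+)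

/-- The degree of a nonempty word: the sum of the degrees of its letters. -/
def wordDeg (u : FreeSemigroup X) : ℕ :=
  (deg u.head : ℕ) + (u.tail.map fun a => (deg a : ℕ)).sum

/-- The deg-length-lex order: compare the degrees, then the lengths, then the letters from left to
right. -/
def DegLenLex (u v : FreeSemigroup X) : Prop :=
  wordDeg deg u < wordDeg deg v ∨ (wordDeg deg u = wordDeg deg v ∧
    (u.length < v.length ∨ (u.length = v.length ∧
      List.Lex (· < ·) (u.head :: u.tail) (v.head :: v.tail))))

/-- The word `u` is the leading monomial of `f`: it is the largest element of the support of `f`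
with respect to the basis `NF(X)`. -/
def IsLeading (f : Lb k X) (u : FreeSemigroup X) : Prop :=
  u ∈ ((Lb.nfBasis k).repr f).support ∧
    ∀ v ∈ ((Lb.nfBasis k).repr f).support, v ≠ u → DegLenLex deg v u

/-- The coefficient of the leading monomial is `1`. -/
def IsMonic (f : Lb k X) : Prop :=
  ∃ u, IsLeading deg f u ∧ (Lb.nfBasis k).repr f u = 1

/-- `h` is a normal `S`-polynomial built from the element `s` of `S`: either
`h = [s a₁ ⋯ aₘ]` with `m ≥ 0`, or `h = [a₁ ⋯ aₜ s aₜ₊₁ ⋯ aₘ]` with `t ≥ 1` and the leading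
monomial of `s` of length `1`. -/
def IsNormalPoly (s h : Lb k X) : Prop :=
  (∃ a : List X, h = leftNormed s (a.map (Lb.of k))) ∨
  ((∃ u, IsLeading deg s u ∧ u.length = 1) ∧
    ∃ (b : FreeSemigroup X) (a : List X), h = leftNormed (Lb.nf k b * s) (a.map (Lb.of k)))

/-- `f ≡ 0 mod (S, u)`: `f` is a linear combination of normal `S`-polynomials whose leading
monomials are less than `u`. -/
def TrivialModWord (S : Set (Lb k X)) (u : FreeSemigroup X) (f : Lb k X) : Prop :=
  f ∈ Submodule.span k {h | (∃ s ∈ S, IsNormalPoly deg s h) ∧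
    ∃ v, IsLeading deg h v ∧ DegLenLex deg v u}

/-- `f ≡ 0 mod (S, n)`: `f` is a linear combination of normal `S`-polynomials whose leading
monomials have degree at most `n`. -/
def TrivialModDeg (S : Set (Lb k X)) (n : ℕ) (f : Lb k X) : Prop :=
  f ∈ Submodule.span k {h | (∃ s ∈ S, IsNormalPoly deg s h) ∧
    ∃ v, IsLeading deg h v ∧ wordDeg deg v ≤ n}

/-- A set `S` of monic elements of `Lb(X)` is a Gröbner–Shirshov basis (for the deg-length-lex
order) if all its inclusion compositions `f - h_g` and all its left multiplication compositions
`[u] f` are trivial. -/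
structure IsGroebnerShirshov (S : Set (Lb k X)) : Prop where
  monic : ∀ s ∈ S, IsMonic deg s
  inclusion : ∀ f ∈ S, ∀ g ∈ S, f ≠ g → ∀ h, IsNormalPoly deg g h →
    ∀ u, IsLeading deg f u → IsLeading deg h u → TrivialModWord deg S u (f - h)
  leftMul : ∀ f ∈ S, ∀ u, IsLeading deg f u → 1 < u.length →
    ∀ v : FreeSemigroup X, Lb.nf k v * f ≠ 0 →
      TrivialModDeg deg S (wordDeg deg v + wordDeg deg u) (Lb.nf k v * f)

end GroebnerShirshov

/-! ## The free metabelian Leibniz algebra -/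

section FreeMetabelian

variable (k : Type u) [Field k] (X : Type v)

/-- The ideal of `Lb(X)` generated by all products `(xy)(zt)`. -/
noncomputable def metabelianIdeal : AlgIdeal k (Lb k X) :=
  AlgIdeal.span k {f | ∃ x y z t, f = (x * y) * (z * t)}

/-- `MLb(X)`: the free metabelian Leibniz algebra generated by `X`. -/
noncomputable abbrev MLb : Type (max u v) := (metabelianIdeal k X).Quot

variable {X}

/-- The generator of `MLb(X)` given by a letter. -/
noncomputable def MLb.of (a : X) : MLb k X := AlgIdeal.Quot.mk (metabelianIdeal k X) (Lb.of k a)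

variable (X)

/-- The set of all `[c₁ ⋯ cₚ a₁ a₂] - [c₁ ⋯ cₚ a₂ a₁]` with `p ≥ 2` and `a₂ < a₁`. -/
def metabelianRelations [LinearOrder X] : Set (Lb k X) :=
  {f | ∃ (c : FreeSemigroup X) (a₁ a₂ : X), 2 ≤ c.length ∧ a₂ < a₁ ∧
    f = leftNormed (Lb.nf k c) [Lb.of k a₁, Lb.of k a₂] -
      leftNormed (Lb.nf k c) [Lb.of k a₂, Lb.of k a₁]}

end FreeMetabelian

/-! The heart of the matter is that the metabelian ideal of `Lb(X)` is the span `R` of all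
differences of two left-normed words that agree in their first two letters and are rearrangements of
each other from the third letter on (`metabelianIdeal_eq_rearrangements`). This comes from a cycle
of inclusions. Each relation in `S₁` is a product `[c₁⋯cₚ](a₁a₂)` with `p ≥ 2`, by the Leibniz
identity, so `Id(S₁)` lies in the metabelian ideal. Any rearrangement is a chain of adjacent
transpositions, each of which is a relation multiplied on the right by letters, so `R` lies in
`Id(S₁)`. Finally `R` is an ideal containing all `(xy)(zt)`. Both facts rest on the congruence `[x
l][c d t] ≡ [x l c d t] - [x l d c t]` modulo `R` (`nf_mul_nf_sub_mem_rearrangements`): on its right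
side, `c` and `d` may be exchanged freely once two letters precede them.

Given this description, sorting the letters from the third one on is a well-defined linear map on
the quotient. It separates the words with sorted tail, and every word is congruent to its sorted
form; this gives the basis.

For the Gröbner–Shirshov property the same congruences are needed with control of sizes. The index
`n` of `rearrangements` bounds degrees, and left multiplication by a word raises it by exactly the
length of that word, which settles left multiplication compositions. Insertion sort only moves down
in the lexicographic order. Hence two rearrangements below a word `m` are connected by
transpositions that stay below `m`, which settles inclusion compositions. -/

open scoped List

/-! ## Sorting by adjacent transpositions -/

section Sorting

variable {k : Type u} [Ring k] {M : Type w} [AddCommGroup M] [Module k M]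
  {X : Type v} [LinearOrder X]

theorem List.orderedInsert_le_cons (a : X) (l : List X) :
    l.orderedInsert (· ≤ ·) a ≤ a :: l := by
  induction l with
  | nil => simp
  | cons b l ih =>
    rw [List.orderedInsert_cons]
    split_ifs with h
    · exact le_rfl
    · exact le_of_lt (List.cons_lt_cons_iff.2 (Or.inl (not_le.1 h)))

/-- Each insertion carries a letter only past strictly smaller ones, so sorting never raises a word.
This keeps leading monomials under control later. -/
theorem List.insertionSort_le (l : List X) : l.insertionSort (· ≤ ·) ≤ l := by
  induction l with
  | nil => simp
  | cons a l ih =>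
    rw [List.insertionSort_cons]
    exact (List.orderedInsert_le_cons a _).trans (List.cons_le_cons a ih)

theorem List.append_le_append_left' (c : List X) {l l' : List X} (h : l ≤ l') :
    c ++ l ≤ c ++ l' := by
  induction c with
  | nil => exact h
  | cons a c ih => exact List.cons_le_cons a ih

variable {K : Submodule k M} {g : List X → M} {P : List X → Prop}

/-- The differences telescope along the successive swaps of an insertion. The predicate `P` is the
size bound to be kept along the way; only downward swaps occur, so it need only be stable under
passing to smaller rearrangements. -/
theorem sub_orderedInsert_mem (hP : ∀ l l', l' ~ l → l' ≤ l → P l → P l')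
    (h : ∀ c a b t, b < a → P (c ++ a :: b :: t) →
      g (c ++ a :: b :: t) - g (c ++ b :: a :: t) ∈ K) (a : X) (l : List X) :
    ∀ c, P (c ++ a :: l) → g (c ++ a :: l) - g (c ++ l.orderedInsert (· ≤ ·) a) ∈ K := by
  induction l with
  | nil => intro c _; simp
  | cons b l ih =>
    intro c hc
    rw [List.orderedInsert_cons]
    split_ifs with hab
    · simp
    · have hba := not_le.1 hab
      have h1 := h c a b l hba hc
      have h2 := ih (c ++ [b]) (by
        rw [List.append_assoc]
        exact hP _ _ ((List.Perm.swap a b l).append_left c)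
          (List.append_le_append_left' c (le_of_lt (List.cons_lt_cons_iff.2 (Or.inl hba)))) hc)
      simp only [List.append_assoc, List.singleton_append] at h2
      simpa using add_mem h1 h2

theorem sub_insertionSort_mem (hP : ∀ l l', l' ~ l → l' ≤ l → P l → P l')
    (h : ∀ c a b t, b < a → P (c ++ a :: b :: t) →
      g (c ++ a :: b :: t) - g (c ++ b :: a :: t) ∈ K) (l : List X) :
    ∀ c, P (c ++ l) → g (c ++ l) - g (c ++ l.insertionSort (· ≤ ·)) ∈ K := by
  induction l with
  | nil => intro c _; simp
  | cons a l ih =>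
    intro c hc
    -- The tail is sorted first, with `a` absorbed into the fixed prefix; then `a` is inserted.
    have h1 := ih (c ++ [a]) (by simpa using hc)
    simp only [List.append_assoc, List.singleton_append] at h1
    have h2 := sub_orderedInsert_mem hP h a (l.insertionSort (· ≤ ·)) c
      (hP _ _ (((List.perm_insertionSort (· ≤ ·) l).cons a).append_left c)
        (List.append_le_append_left' c (List.cons_le_cons a (List.insertionSort_le l))) hc)
    rw [List.insertionSort_cons]
    simpa using add_mem h1 h2

theorem List.Perm.insertionSort_eq {l l' : List X} (h : l ~ l') :
    l.insertionSort (· ≤ ·) = l'.insertionSort (· ≤ ·) :=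
  (((List.perm_insertionSort _ l).trans h).trans
    (List.perm_insertionSort _ l').symm).eq_of_pairwise'
      (List.pairwise_insertionSort _ l) (List.pairwise_insertionSort _ l')

/-- Two rearrangements of a word are congruent if adjacent transpositions are. -/
theorem sub_mem_of_perm (hP : ∀ l l', l' ~ l → l' ≤ l → P l → P l')
    (h : ∀ c a b t, b < a → P (c ++ a :: b :: t) →
      g (c ++ a :: b :: t) - g (c ++ b :: a :: t) ∈ K) {l l' : List X} (hl : l ~ l')
    (h1 : P l) (h2 : P l') : g l - g l' ∈ K := by
  -- Both words descend to the same sorted word, so no upward swap is ever needed.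
  have e1 := sub_insertionSort_mem hP h l [] h1
  have e2 := sub_insertionSort_mem hP h l' [] h2
  simp only [List.nil_append] at e1 e2
  rw [hl.insertionSort_eq] at e1
  simpa using sub_mem e1 e2

end Sorting

/-! ## Products of left-normed words modulo rearrangements -/

section Rearrangements

variable (k : Type u) [Field k] (X : Type v)

/-- The span of all differences `[x y a₁ ⋯ aₘ] - [x y b₁ ⋯ bₘ]`, `m + 2 ≤ n`, where `b₁, …, bₘ` is a
rearrangement of `a₁, …, aₘ`. -/
noncomputable def rearrangements (n : ℕ∞) : Submodule k (Lb k X) :=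
  Submodule.span k {f | ∃ (x y : X) (l l' : List X), l ~ l' ∧ ((l.length + 2 : ℕ) : ℕ∞) ≤ n ∧
    f = Lb.nf k ⟨x, y :: l⟩ - Lb.nf k ⟨x, y :: l'⟩}

variable {X}

theorem Lb.nf_concat (x : X) (l : List X) (a : X) :
    Lb.nf k ⟨x, l ++ [a]⟩ = Lb.nf k ⟨x, l⟩ * Lb.of k a := Lb.nf_mul_of k ⟨x, l⟩ a

theorem Lb.leftNormed_nf (x : X) (l t : List X) :
    leftNormed (Lb.nf k ⟨x, l⟩) (t.map (Lb.of k)) = Lb.nf k ⟨x, l ++ t⟩ := by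
  simp [leftNormed, Lb.nf]

theorem leftNormed_sub {A : Type w} [NonUnitalNonAssocRing A] (f g : A) (l : List A) :
    leftNormed (f - g) l = leftNormed f l - leftNormed g l := by
  induction l generalizing f g with
  | nil => rfl
  | cons a l ih =>
    show leftNormed ((f - g) * a) l = _
    rw [sub_mul, ih]
    rfl

variable {k}

theorem nf_sub_nf_mem_rearrangements {n : ℕ∞} (x y : X) {l l' : List X} (h : l ~ l')
    (hn : ((l.length + 2 : ℕ) : ℕ∞) ≤ n) :
    Lb.nf k ⟨x, y :: l⟩ - Lb.nf k ⟨x, y :: l'⟩ ∈ rearrangements k X n :=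
  Submodule.subset_span ⟨x, y, l, l', h, hn, rfl⟩

theorem mul_of_mem_rearrangements {n : ℕ∞} {f : Lb k X} (hf : f ∈ rearrangements k X n) (a : X) :
    f * Lb.of k a ∈ rearrangements k X (n + 1) := by
  induction hf using Submodule.span_induction with
  | mem f hf =>
    obtain ⟨x, y, l, l', h, hn, rfl⟩ := hf
    rw [sub_mul, ← Lb.nf_concat, ← Lb.nf_concat]
    refine nf_sub_nf_mem_rearrangements x y (l := l ++ [a]) (l' := l' ++ [a])
      (h.append_right [a]) ?_
    have := add_le_add_left hn 1
    rw [List.length_append, List.length_singleton]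
    push_cast at this ⊢
    rwa [add_right_comm]
  | zero => simp
  | add f g _ _ hf hg => rw [add_mul]; exact add_mem hf hg
  | smul c f _ hf => rw [smul_mul_assoc]; exact Submodule.smul_mem _ _ hf

theorem rearrangements_mono {m n : ℕ∞} (h : m ≤ n) :
    rearrangements k X m ≤ rearrangements k X n :=
  Submodule.span_mono fun _ ⟨x, y, l, l', hl, hm, e⟩ => ⟨x, y, l, l', hl, hm.trans h, e⟩

/-- `[x l] [c d t]` is congruent to `[x l c d t] - [x l d c t]`. -/
theorem nf_mul_nf_sub_mem_rearrangements (c d : X) (t : List X) :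
    ∀ (x : X) (l : List X), Lb.nf k ⟨x, l⟩ * Lb.nf k ⟨c, d :: t⟩ -
      (Lb.nf k ⟨x, l ++ c :: d :: t⟩ - Lb.nf k ⟨x, l ++ d :: c :: t⟩) ∈
        rearrangements k X ((l.length + t.length + 3 : ℕ) : ℕ∞) := by
  induction t using List.reverseRecOn with
  | nil =>
    intro x l
    have e1 : Lb.nf k ⟨c, [d]⟩ = Lb.of k c * Lb.of k d := rfl
    have e2 : ∀ a b : X, Lb.nf k ⟨x, l ++ [a, b]⟩ = Lb.nf k ⟨x, l⟩ * Lb.of k a * Lb.of k b := by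
      intro a b
      rw [← Lb.nf_concat, ← Lb.nf_concat, List.append_assoc]
      rfl
    rw [e1, e2, e2, IsLeibniz.leibniz, sub_self]
    exact zero_mem _
  | append_singleton t a ih =>
    intro x l
    -- The Leibniz identity `f(ga) = (fg)a - (fa)g` splits the product. `h1` treats `(fg)a`, which
    -- gives the two expected words; `h2` treats `(fa)g`.
    have h1 := mul_of_mem_rearrangements (ih x l) a
    have h2 := ih x (l ++ [a])
    -- What remains of `(fa)g` vanishes modulo rearrangements: `c` and `d` are now preceded by at
    -- least two letters, even when `l` is empty, because `a` has moved in front of them.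
    have h3 : Lb.nf k ⟨x, l ++ [a] ++ c :: d :: t⟩ - Lb.nf k ⟨x, l ++ [a] ++ d :: c :: t⟩ ∈
        rearrangements k X ((l.length + (t ++ [a]).length + 3 : ℕ) : ℕ∞) := by
      cases l with
      | nil =>
        refine nf_sub_nf_mem_rearrangements x a (l := c :: d :: t) (l' := d :: c :: t)
          (List.Perm.swap d c t) ?_
        simp only [List.length_append, List.length_cons, List.length_nil, Nat.cast_le]
        omega
      | cons y l =>
        refine nf_sub_nf_mem_rearrangements x y
          (l := l ++ [a] ++ c :: d :: t) (l' := l ++ [a] ++ d :: c :: t) ((List.Perm.swap d c t).append_left _) ?_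
        simp only [List.length_append, List.length_cons, List.length_nil, Nat.cast_le]
        omega
    have e0 : Lb.nf k ⟨c, d :: (t ++ [a])⟩ = Lb.nf k ⟨c, d :: t⟩ * Lb.of k a :=
      Lb.nf_concat k c (d :: t) a
    have e1 : ∀ c d : X, Lb.nf k ⟨x, l ++ c :: d :: (t ++ [a])⟩ =
        Lb.nf k ⟨x, l ++ c :: d :: t⟩ * Lb.of k a := by
      intro c d
      rw [← Lb.nf_concat, List.append_assoc]
      rfl
    have h1' : _ ∈ rearrangements k X ((l.length + (t ++ [a]).length + 3 : ℕ) : ℕ∞) :=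
      rearrangements_mono (le_of_eq (by
        rw [List.length_append, List.length_singleton]; push_cast; ring)) h1
    have h2' : _ ∈ rearrangements k X ((l.length + (t ++ [a]).length + 3 : ℕ) : ℕ∞) :=
      rearrangements_mono (le_of_eq (by
        simp only [List.length_append, List.length_singleton]; push_cast; ring)) h2
    rw [e0, e1, e1, IsLeibniz.leibniz, ← Lb.nf_concat k x l a]
    rw [sub_mul, sub_mul] at h1'
    convert sub_mem h1' (add_mem h2' h3) using 1
    abel

/-- Left multiplication by a word sends rearrangements to rearrangements. -/
theorem nf_mul_mem_rearrangements (x : X) (l : List X) {n : ℕ∞} {f : Lb k X}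
    (hf : f ∈ rearrangements k X n) :
    Lb.nf k ⟨x, l⟩ * f ∈ rearrangements k X (((l.length + 1 : ℕ) : ℕ∞) + n) := by
  induction hf using Submodule.span_induction with
  | mem f hf =>
    obtain ⟨c, d, t, t', h, hn, rfl⟩ := hf
    have hle : ((l.length + t.length + 3 : ℕ) : ℕ∞) ≤ ((l.length + 1 : ℕ) : ℕ∞) + n := by
      refine le_trans (le_of_eq ?_) (add_le_add_right hn _)
      push_cast
      ring
    have h1 := rearrangements_mono hle (nf_mul_nf_sub_mem_rearrangements (k := k) c d t x l)
    have h2 := nf_mul_nf_sub_mem_rearrangements (k := k) c d t' x l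
    rw [← h.length_eq] at h2
    have h3 : ∀ c d : X, Lb.nf k ⟨x, l ++ c :: d :: t⟩ - Lb.nf k ⟨x, l ++ c :: d :: t'⟩ ∈
        rearrangements k X (((l.length + 1 : ℕ) : ℕ∞) + n) := by
      intro c d
      refine rearrangements_mono hle ?_
      -- When `l` is empty the protected second letter is `c` itself; the permutation only affects
      -- what follows it.
      cases l with
      | nil =>
        refine nf_sub_nf_mem_rearrangements x c (h.cons d) ?_
        simp only [List.length_cons, List.length_nil, Nat.cast_le]
        omega
      | cons y l =>
        refine nf_sub_nf_mem_rearrangements x y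
          (l := l ++ c :: d :: t) (l' := l ++ c :: d :: t') (((h.cons d).cons c).append_left l) ?_
        simp only [List.length_append, List.length_cons, Nat.cast_le]
        omega
    rw [mul_sub]
    convert add_mem (sub_mem h1 (rearrangements_mono hle h2)) (sub_mem (h3 c d) (h3 d c)) using 1
    abel
  | zero => simp
  | add f g _ _ hf hg => rw [mul_add]; exact add_mem hf hg
  | smul c f _ hf => rw [mul_smul_comm]; exact Submodule.smul_mem _ _ hf

theorem Lb.mem_span_nf (f : Lb k X) : f ∈ Submodule.span k (Set.range (Lb.nf k (X := X))) :=
  Lb.span_nf k trivial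

theorem mul_mem_rearrangements_left (g : Lb k X) {f : Lb k X} (hf : f ∈ rearrangements k X ⊤) :
    g * f ∈ rearrangements k X ⊤ := by
  induction Lb.mem_span_nf g using Submodule.span_induction with
  | mem g hg =>
    obtain ⟨⟨x, l⟩, rfl⟩ := hg
    exact rearrangements_mono le_top (nf_mul_mem_rearrangements x l hf)
  | zero => simp
  | add g h _ _ hg hh => rw [add_mul]; exact add_mem hg hh
  | smul c g _ hg => rw [smul_mul_assoc]; exact Submodule.smul_mem _ _ hg

/-- A subspace that is closed under right multiplication by letters is closed under right
multiplication. -/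
theorem Lb.mul_mem_of_mul_of_mem {K : Submodule k (Lb k X)}
    (h : ∀ f ∈ K, ∀ a, f * Lb.of k a ∈ K) (g : Lb k X) : ∀ f ∈ K, f * g ∈ K := by
  induction Lb.mem_span_nf g using Submodule.span_induction with
  | mem g hg =>
    obtain ⟨u, rfl⟩ := hg
    induction u using FreeSemigroup.rightInd with
    | h1 a => exact fun f hf => h f hf a
    | h2 u a ih =>
      intro f hf
      rw [Lb.nf_mul_of, IsLeibniz.leibniz]
      exact sub_mem (h _ (ih f hf) a) (ih _ (h f hf a))
  | zero => intro f _; simp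
  | add g h _ _ hg hh => intro f hf; rw [mul_add]; exact add_mem (hg f hf) (hh f hf)
  | smul c g _ hg => intro f hf; rw [mul_smul_comm]; exact Submodule.smul_mem _ _ (hg f hf)

theorem mul_mem_rearrangements_right (g : Lb k X) {f : Lb k X} (hf : f ∈ rearrangements k X ⊤) :
    f * g ∈ rearrangements k X ⊤ :=
  Lb.mul_mem_of_mul_of_mem 
    (fun _ hf a => rearrangements_mono le_top (mul_of_mem_rearrangements hf a)) g f hf

/-- Every product is a combination of words of length at least two, which supplies the two protected
letters of a rearrangement. -/
theorem Lb.mul_mem_span_nf_cons (f g : Lb k X) :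
    f * g ∈ Submodule.span k {h | ∃ (x y : X) (l : List X), h = Lb.nf k ⟨x, y :: l⟩} := by
  have key : ∀ (f : Lb k X) (a : X), f * Lb.of k a ∈
      Submodule.span k {h | ∃ (x y : X) (l : List X), h = Lb.nf k ⟨x, y :: l⟩} := by
    intro f a
    induction Lb.mem_span_nf f using Submodule.span_induction with
    | mem f hf =>
      obtain ⟨⟨x, l⟩, rfl⟩ := hf
      rw [← Lb.nf_concat]
      cases l with
      | nil => exact Submodule.subset_span ⟨x, a, [], rfl⟩
      | cons y l => exact Submodule.subset_span ⟨x, y, l ++ [a], rfl⟩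
    | zero => simp
    | add f g _ _ hf hg => rw [add_mul]; exact add_mem hf hg
    | smul c f _ hf => rw [smul_mul_assoc]; exact Submodule.smul_mem _ _ hf
  induction Lb.mem_span_nf g using Submodule.span_induction generalizing f with
  | mem g hg =>
    obtain ⟨u, rfl⟩ := hg
    induction u using FreeSemigroup.rightInd generalizing f with
    | h1 a => exact key f a
    | h2 u a ih =>
      rw [Lb.nf_mul_of, IsLeibniz.leibniz]
      exact sub_mem (key _ a) (ih _)
  | zero => simp
  | add g h _ _ hg hh => rw [mul_add]; exact add_mem (hg f) (hh f)
  | smul c g _ hg => rw [mul_smul_comm]; exact Submodule.smul_mem _ _ (hg f)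

theorem mul_mul_mul_mem_rearrangements (x y z t : Lb k X) :
    (x * y) * (z * t) ∈ rearrangements k X ⊤ := by
  have hxy := Lb.mul_mem_span_nf_cons x y
  have hzt := Lb.mul_mem_span_nf_cons z t
  generalize x * y = f at hxy
  generalize z * t = g at hzt
  induction hxy using Submodule.span_induction with
  | mem f hf =>
    obtain ⟨a, b, l, rfl⟩ := hf
    induction hzt using Submodule.span_induction with
    | mem g hg =>
      obtain ⟨c, d, m, rfl⟩ := hg
      have h := rearrangements_mono le_top
        (nf_mul_nf_sub_mem_rearrangements (k := k) c d m a (b :: l))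
      -- The letters `a` and `b` precede the swap, so the two words approximating the product are
      -- themselves congruent.
      have h' : Lb.nf k ⟨a, b :: l ++ c :: d :: m⟩ - Lb.nf k ⟨a, b :: l ++ d :: c :: m⟩ ∈
          rearrangements k X ⊤ := nf_sub_nf_mem_rearrangements a b
            (l' := l ++ d :: c :: m) ((List.Perm.swap d c m).append_left l) le_top
      simpa using add_mem h h'
    | zero => simp
    | add f g _ _ hf hg => rw [mul_add]; exact add_mem hf hg
    | smul c f _ hf => rw [mul_smul_comm]; exact Submodule.smul_mem _ _ hf
  | zero => simp
  | add f g _ _ hf hg => rw [add_mul]; exact add_mem hf hg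
  | smul c f _ hf => rw [smul_mul_assoc]; exact Submodule.smul_mem _ _ hf

theorem metabelianIdeal_le_rearrangements :
    (metabelianIdeal k X).toSubmodule ≤ rearrangements k X ⊤ := by
  refine AlgIdeal.span_le ?_ (fun a b => mul_mem_rearrangements_left a)
    (fun a b => mul_mem_rearrangements_right a)
  rintro _ ⟨x, y, z, t, rfl⟩
  exact mul_mul_mul_mem_rearrangements x y z t

variable (k) in
/-- The elements `[x y c a b t] - [x y c b a t]`. -/
noncomputable def swapPoly (x y : X) (c : List X) (a b : X) (t : List X) : Lb k X :=
  Lb.nf k ⟨x, y :: (c ++ a :: b :: t)⟩ - Lb.nf k ⟨x, y :: (c ++ b :: a :: t)⟩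

theorem leftNormed_swapPoly (x y : X) (c : List X) (a b : X) (t : List X) :
    leftNormed (swapPoly k x y c a b []) (t.map (Lb.of k)) = swapPoly k x y c a b t := by
  simp [swapPoly, leftNormed_sub, Lb.leftNormed_nf]

theorem leftNormed_mem {I : AlgIdeal k (Lb k X)} {f : Lb k X} (hf : f ∈ I.toSubmodule)
    (l : List (Lb k X)) : leftNormed f l ∈ I.toSubmodule := by
  induction l generalizing f with
  | nil => exact hf
  | cons a l ih => exact ih (I.mul_mem_right' a hf)

end Rearrangements

/-! ### The ideal generated by the relations `S₁` -/

section Relations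

variable (k : Type u) [Field k] (X : Type v) [LinearOrder X]

variable {k X}

theorem mem_metabelianRelations_iff {f : Lb k X} :
    f ∈ metabelianRelations k X ↔ ∃ x y c a b, b < a ∧ f = swapPoly k x y c a b [] := by
  constructor
  · rintro ⟨⟨x, l⟩, a, b, hc, hab, rfl⟩
    cases l with
    | nil => exact absurd hc (by decide : ¬ 2 ≤ 1)
    | cons y c =>
      exact ⟨x, y, c, a, b, hab, congrArg₂ (· - ·) (Lb.leftNormed_nf k x (y :: c) [a, b])
        (Lb.leftNormed_nf k x (y :: c) [b, a])⟩
  · rintro ⟨x, y, c, a, b, hab, rfl⟩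
    exact ⟨⟨x, y :: c⟩, a, b, Nat.le_add_left 2 c.length, hab,
      congrArg₂ (· - ·) (Lb.leftNormed_nf k x (y :: c) [a, b]).symm
        (Lb.leftNormed_nf k x (y :: c) [b, a]).symm⟩

theorem rearrangements_le_span_metabelianRelations :
    rearrangements k X ⊤ ≤ (AlgIdeal.span k (metabelianRelations k X)).toSubmodule := by
  refine Submodule.span_le.2 ?_
  rintro _ ⟨x, y, l, l', h, -, rfl⟩
  refine sub_mem_of_perm (g := fun l => Lb.nf k ⟨x, y :: l⟩) (P := fun _ => True)
    (fun _ _ _ _ _ => trivial) (fun c a b t hab _ => ?_) h trivial trivial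
  have h1 := leftNormed_mem (AlgIdeal.subset_span (k := k) (metabelianRelations k X)
    (mem_metabelianRelations_iff.2 ⟨x, y, c, a, b, hab, rfl⟩)) (t.map (Lb.of k))
  rwa [leftNormed_swapPoly] at h1

theorem span_metabelianRelations_le :
    (AlgIdeal.span k (metabelianRelations k X)).toSubmodule ≤
      (metabelianIdeal k X).toSubmodule := by
  refine AlgIdeal.span_le ?_ (fun a b => (metabelianIdeal k X).mul_mem_left' a)
    (fun a b => (metabelianIdeal k X).mul_mem_right' a)
  rintro _ ⟨c, a, b, hc, -, rfl⟩
  induction c using FreeSemigroup.rightInd with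
  | h1 x => exact absurd hc (by decide : ¬ 2 ≤ 1)
  | h2 c x ih =>
    -- Since `p ≥ 2`, the prefix is a product `c x`, and the relation equals `(c x)(a b)`.
    refine AlgIdeal.subset_span _ ⟨Lb.nf k c, Lb.of k x, Lb.of k a, Lb.of k b, ?_⟩
    rw [IsLeibniz.leibniz, ← Lb.nf_mul_of]
    rfl

theorem AlgIdeal.toSubmodule_injective {A : Type w} [NonUnitalNonAssocRing A] [Module k A] :
    Function.Injective (AlgIdeal.toSubmodule : AlgIdeal k A → Submodule k A) := by
  rintro ⟨I, _, _⟩ ⟨J, _, _⟩ h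
  congr

theorem span_metabelianRelations :
    AlgIdeal.span k (metabelianRelations k X) = metabelianIdeal k X :=
  AlgIdeal.toSubmodule_injective (le_antisymm span_metabelianRelations_le
    (metabelianIdeal_le_rearrangements.trans rearrangements_le_span_metabelianRelations))

theorem metabelianIdeal_eq_rearrangements :
    (metabelianIdeal k X).toSubmodule = rearrangements k X ⊤ :=
  le_antisymm metabelianIdeal_le_rearrangements
    (rearrangements_le_span_metabelianRelations.trans span_metabelianRelations_le)

end Relations
/-! ## The universal property -/

section UniversalProperty

section

variable {k : Type u} [CommRing k] {A : Type v} [NonUnitalNonAssocRing A] [Module k A]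

/-- The canonical projection `A → A / I`, as a homomorphism of algebras. -/
def AlgIdeal.Quot.mkHom (I : AlgIdeal k A) : A →ₙₐ[k] I.Quot where
  toFun := AlgIdeal.Quot.mk I
  map_smul' r x := map_smul _ r x
  map_zero' := map_zero _
  map_add' := map_add _
  map_mul' := AlgIdeal.Quot.mk_mul I

/-- A homomorphism that vanishes on an ideal factors through the quotient. -/
def AlgIdeal.Quot.liftHom (I : AlgIdeal k A) {B : Type w} [NonUnitalNonAssocRing B] [Module k B]
    (F : A →ₙₐ[k] B) (h : ∀ a ∈ I.toSubmodule, F a = 0) : I.Quot →ₙₐ[k] B :=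
  let G : I.Quot →ₗ[k] B := Submodule.liftQ _ (F : A →ₗ[k] B) h
  { toFun := G
    map_smul' := fun r x => map_smul G r x
    map_zero' := map_zero G
    map_add' := map_add G
    map_mul' := fun x y => by
      obtain ⟨x, rfl⟩ := AlgIdeal.Quot.mk_surjective I x
      obtain ⟨y, rfl⟩ := AlgIdeal.Quot.mk_surjective I y
      exact map_mul F x y }

theorem AlgIdeal.map_eq_zero_of_mem_span {B : Type w} [NonUnitalNonAssocRing B] [Module k B]
    (F : A →ₙₐ[k] B) {S : Set A} (h : ∀ s ∈ S, F s = 0) :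
    ∀ a ∈ (AlgIdeal.span k S).toSubmodule, F a = 0 := by
  refine AlgIdeal.span_le (J := LinearMap.ker (F : A →ₗ[k] B)) h ?_ ?_
  · intro a b hb
    have hb' : F b = 0 := hb
    show F (a * b) = 0
    rw [map_mul, hb', mul_zero]
  · intro a b hb
    have hb' : F b = 0 := hb
    show F (b * a) = 0
    rw [map_mul, hb', zero_mul]

theorem IsMetabelian.mul_mul_mul (h : IsMetabelian k A) (x y z t : A) :
    (x * y) * (z * t) = 0 := by
  obtain ⟨I, h0, h1⟩ := h
  have hI : ∀ x y : A, x * y ∈ I.toSubmodule := by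
    intro x y
    have e := h1 (AlgIdeal.Quot.mk I x) (AlgIdeal.Quot.mk I y)
    rw [← AlgIdeal.Quot.mk_mul, ← map_zero (AlgIdeal.Quot.mk I), AlgIdeal.Quot.mk_eq_mk,
      sub_zero] at e
    exact e
  exact h0 _ (hI x y) _ (hI z t)

/-- The witness is the span of all products: it is an ideal, and the quotient by it has zero
multiplication. -/
theorem isMetabelian_of_mul_mul_mul [IsScalarTower k A A] [SMulCommClass k A A]
    (h : ∀ x y z t : A, (x * y) * (z * t) = 0) : IsMetabelian k A := by
  have hmem : ∀ x y : A, x * y ∈ Submodule.span k {h | ∃ x y : A, h = x * y} := fun x y =>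
    Submodule.subset_span ⟨x, y, rfl⟩
  refine ⟨⟨Submodule.span k {h | ∃ x y : A, h = x * y}, fun a b _ => hmem a b,
    fun a b _ => hmem b a⟩, ?_, ?_⟩
  · intro x hx y hy
    change x ∈ Submodule.span k {h | ∃ x y : A, h = x * y} at hx
    change y ∈ Submodule.span k {h | ∃ x y : A, h = x * y} at hy
    induction hx using Submodule.span_induction with
    | mem x hx =>
      obtain ⟨a, b, rfl⟩ := hx
      induction hy using Submodule.span_induction with
      | mem y hy =>
        obtain ⟨c, d, rfl⟩ := hy
        exact h a b c d
      | zero => simp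
      | add f g _ _ hf hg => rw [mul_add, hf, hg, add_zero]
      | smul c f _ hf => rw [mul_smul_comm, hf, smul_zero]
    | zero => simp
    | add f g _ _ hf hg => rw [add_mul, hf, hg, add_zero]
    | smul c f _ hf => rw [smul_mul_assoc, hf, smul_zero]
  · intro x y
    obtain ⟨x, rfl⟩ := AlgIdeal.Quot.mk_surjective _ x
    obtain ⟨y, rfl⟩ := AlgIdeal.Quot.mk_surjective _ y
    rw [← AlgIdeal.Quot.mk_mul, ← map_zero (AlgIdeal.Quot.mk _), AlgIdeal.Quot.mk_eq_mk, sub_zero]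
    exact hmem x y

end

variable (k : Type u) [Field k] (X : Type v)

theorem isMetabelian_MLb : IsMetabelian k (MLb k X) := by
  refine isMetabelian_of_mul_mul_mul fun x y z t => ?_
  obtain ⟨x, rfl⟩ := AlgIdeal.Quot.mk_surjective _ x
  obtain ⟨y, rfl⟩ := AlgIdeal.Quot.mk_surjective _ y
  obtain ⟨z, rfl⟩ := AlgIdeal.Quot.mk_surjective _ z
  obtain ⟨t, rfl⟩ := AlgIdeal.Quot.mk_surjective _ t
  simp only [← AlgIdeal.Quot.mk_mul]
  rw [← map_zero (AlgIdeal.Quot.mk _), AlgIdeal.Quot.mk_eq_mk, sub_zero]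
  exact AlgIdeal.subset_span _ ⟨x, y, z, t, rfl⟩

theorem isFreeMetabelianLeibniz_MLb :
    IsFreeMetabelianLeibniz.{u, v, max u v, w} k (MLb.of k : X → MLb k X) := by
  refine ⟨inferInstance, isMetabelian_MLb k X, fun A _ _ _ _ _ hA φ => ?_⟩
  let F₀ : FreeNonUnitalNonAssocAlgebra k X →ₙₐ[k] A := FreeNonUnitalNonAssocAlgebra.lift k φ
  have h₀ : ∀ a ∈ (leibnizIdeal k X).toSubmodule, F₀ a = 0 := by
    refine AlgIdeal.map_eq_zero_of_mem_span F₀ ?_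
    rintro _ ⟨x, y, z, rfl⟩
    simp [IsLeibniz.leibniz (F₀ x)]
  let F₁ : Lb k X →ₙₐ[k] A := AlgIdeal.Quot.liftHom _ F₀ h₀
  have h₁ : ∀ a ∈ (metabelianIdeal k X).toSubmodule, F₁ a = 0 := by
    refine AlgIdeal.map_eq_zero_of_mem_span F₁ ?_
    rintro _ ⟨x, y, z, t, rfl⟩
    simp only [map_mul, hA.mul_mul_mul]
  refine ⟨AlgIdeal.Quot.liftHom _ F₁ h₁, fun x => ?_, fun Φ hΦ => ?_⟩
  · exact FreeNonUnitalNonAssocAlgebra.lift_of_apply k φ x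
  -- Uniqueness is tested after pulling back along both projections to the free non-associative
  -- algebra.
  · have e : (Φ.comp (AlgIdeal.Quot.mkHom (metabelianIdeal k X))).comp
        (AlgIdeal.Quot.mkHom (leibnizIdeal k X)) = F₀ := by
      refine FreeNonUnitalNonAssocAlgebra.hom_ext k fun x => ?_
      exact (hΦ x).trans (FreeNonUnitalNonAssocAlgebra.lift_of_apply k φ x).symm
    ext f
    obtain ⟨f, rfl⟩ := AlgIdeal.Quot.mk_surjective _ f
    obtain ⟨f, rfl⟩ := AlgIdeal.Quot.mk_surjective _ f
    exact DFunLike.congr_fun e f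

end UniversalProperty

/-! ## The linear basis of the free metabelian Leibniz algebra -/

section MetabelianBasis

variable (k : Type u) [Field k] (X : Type v) [LinearOrder X]

/-- The words `a₁ a₂ ⋯ aₙ`, `n ≥ 1`, with `a₃ ≤ a₄ ≤ ⋯ ≤ aₙ`. -/
abbrev MetabelianWord : Type v := {u : FreeSemigroup X // u.tail.tail.IsChain (· ≤ ·)}

variable {X}

/-- Sorting the letters of a word from the third one on. -/
def sortWord : FreeSemigroup X → MetabelianWord X
  | ⟨x, []⟩ => ⟨⟨x, []⟩, List.isChain_nil⟩
  | ⟨x, y :: l⟩ => ⟨⟨x, y :: l.insertionSort (· ≤ ·)⟩,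
      List.isChain_iff_pairwise.2 (List.pairwise_insertionSort (· ≤ ·) l)⟩

theorem sortWord_coe (u : MetabelianWord X) : sortWord u.1 = u := by
  obtain ⟨⟨x, l⟩, h⟩ := u
  cases l with
  | nil => rfl
  | cons y l =>
    have e : l.insertionSort (· ≤ ·) = l :=
      (List.isChain_iff_pairwise.1 h).insertionSort_eq
    simp only [sortWord, e]

theorem nf_sub_nf_sortWord_mem (u : FreeSemigroup X) :
    Lb.nf k u - Lb.nf k (sortWord u).1 ∈ (metabelianIdeal k X).toSubmodule := by
  rw [metabelianIdeal_eq_rearrangements]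
  obtain ⟨x, l⟩ := u
  cases l with
  | nil => simp [sortWord]
  | cons y l =>
    exact nf_sub_nf_mem_rearrangements x y (List.perm_insertionSort (· ≤ ·) l).symm le_top

/-- The linear map that sends `[a₁ ⋯ aₙ]` to the word obtained by sorting `a₃, …, aₙ`. -/
noncomputable def Lb.sort : Lb k X →ₗ[k] MetabelianWord X →₀ k :=
  (Lb.nfBasis k).constr k fun u => Finsupp.single (sortWord u) 1

theorem Lb.sort_nf (u : FreeSemigroup X) :
    Lb.sort k (Lb.nf k u) = Finsupp.single (sortWord u) 1 := by
  rw [← Lb.nfBasis_apply]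
  exact (Lb.nfBasis k).constr_basis k _ u

theorem metabelianIdeal_le_ker_sort :
    (metabelianIdeal k X).toSubmodule ≤ LinearMap.ker (Lb.sort k) := by
  rw [metabelianIdeal_eq_rearrangements]
  refine Submodule.span_le.2 ?_
  rintro _ ⟨x, y, l, l', h, -, rfl⟩
  show Lb.sort k _ = 0
  rw [map_sub, Lb.sort_nf, Lb.sort_nf]
  simp only [sortWord, h.insertionSort_eq, sub_self]

/-- The linear map on the quotient induced by `Lb.sort`. -/
noncomputable def MLb.sort : MLb k X →ₗ[k] MetabelianWord X →₀ k :=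
  Submodule.liftQ _ _ (metabelianIdeal_le_ker_sort k)

/-- The image of `[a₁ ⋯ aₙ]` in the free metabelian Leibniz algebra. -/
noncomputable def MLb.nf (u : FreeSemigroup X) : MLb k X :=
  AlgIdeal.Quot.mk (metabelianIdeal k X) (Lb.nf k u)

theorem MLb.sort_nf (u : MetabelianWord X) : MLb.sort k (MLb.nf k u.1) = Finsupp.single u 1 := by
  conv_rhs => rw [← sortWord_coe u]
  exact Lb.sort_nf k u.1

/-- `MLb.sort` carries these elements to the standard basis vectors. -/
theorem MLb.linearIndependent_nf :
    LinearIndependent k fun u : MetabelianWord X => MLb.nf k u.1 := by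
  refine LinearIndependent.of_comp (MLb.sort k) ?_
  have e : (MLb.sort k ∘ fun u : MetabelianWord X => MLb.nf k u.1) =
      fun u => Finsupp.single u 1 := funext (MLb.sort_nf k)
  rw [e]
  exact Finsupp.linearIndependent_single_one k _

theorem MLb.span_nf :
    ⊤ ≤ Submodule.span k (Set.range fun u : MetabelianWord X => MLb.nf k u.1) := by
  rintro f -
  obtain ⟨f, rfl⟩ := AlgIdeal.Quot.mk_surjective _ f
  induction Lb.mem_span_nf f using Submodule.span_induction with
  | mem f hf =>
    obtain ⟨u, rfl⟩ := hf
    rw [(AlgIdeal.Quot.mk_eq_mk _).2 (nf_sub_nf_sortWord_mem k u)]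
    exact Submodule.subset_span ⟨sortWord u, rfl⟩
  | zero => simp
  | add f g _ _ hf hg => rw [map_add]; exact add_mem hf hg
  | smul c f _ hf => rw [map_smul]; exact Submodule.smul_mem _ _ hf

omit [LinearOrder X] in
theorem MLb.nf_eq_leftNormed (u : FreeSemigroup X) :
    MLb.nf k u = leftNormed (MLb.of k u.head) (u.tail.map (MLb.of k)) := by
  induction u using FreeSemigroup.rightInd with
  | h1 a => rfl
  | h2 u a ih =>
    have e : MLb.nf k (u * FreeSemigroup.of a) = MLb.nf k u * MLb.of k a := by
      rw [MLb.nf, Lb.nf_mul_of]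
      rfl
    show _ = leftNormed _ (List.map _ (u.tail ++ [a]))
    rw [e, ih, List.map_append, leftNormed, leftNormed, List.foldl_append]
    rfl

/-- The elements `[a₁ a₂ ⋯ aₙ]` with `a₃ ≤ a₄ ≤ ⋯ ≤ aₙ` form a basis. -/
noncomputable def MLb.nfBasis : Module.Basis (MetabelianWord X) k (MLb k X) :=
  Module.Basis.mk (MLb.linearIndependent_nf k) (MLb.span_nf k)

theorem MLb.nfBasis_apply (u : MetabelianWord X) :
    MLb.nfBasis k u = leftNormed (MLb.of k u.1.head) (u.1.tail.map (MLb.of k)) :=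
  (Module.Basis.mk_apply _ _ u).trans (MLb.nf_eq_leftNormed k u.1)

end MetabelianBasis
/-! ## The Gröbner–Shirshov basis -/

section MetabelianGroebnerShirshov

variable {k : Type u} [Field k] {X : Type v} [LinearOrder X]

theorem DegLenLex.asymm {deg : X → ℕ+} {u v : FreeSemigroup X} (h : DegLenLex deg u v)
    (h' : DegLenLex deg v u) : False := by
  rcases h with h | ⟨e, h | ⟨e', h⟩⟩ <;> rcases h' with h' | ⟨f, h' | ⟨f', h'⟩⟩ <;>
    first | omega | exact asymm_of (List.Lex (· < ·)) h h'

theorem IsLeading.unique {deg : X → ℕ+} {f : Lb k X} {u v : FreeSemigroup X}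
    (hu : IsLeading deg f u) (hv : IsLeading deg f v) : u = v := by
  by_contra h
  exact (hu.2 v hv.1 (Ne.symm h)).asymm (hv.2 u hu.1 h)

omit [LinearOrder X] in
theorem Lb.repr_nf_sub_nf (u v : FreeSemigroup X) :
    (Lb.nfBasis k).repr (Lb.nf k u - Lb.nf k v) = Finsupp.single u 1 - Finsupp.single v 1 := by
  rw [← Lb.nfBasis_apply, ← Lb.nfBasis_apply, map_sub, Module.Basis.repr_self,
    Module.Basis.repr_self]

omit [LinearOrder X] in
theorem repr_nf_sub_nf_apply {u v : FreeSemigroup X} (h : v ≠ u) :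
    (Lb.nfBasis k).repr (Lb.nf k u - Lb.nf k v) u = 1 := by
  rw [Lb.repr_nf_sub_nf, Finsupp.sub_apply, Finsupp.single_eq_same,
    Finsupp.single_eq_of_ne h.symm, sub_zero]

theorem isLeading_nf_sub_nf {deg : X → ℕ+} {u v : FreeSemigroup X} (h : DegLenLex deg v u) :
    IsLeading deg (Lb.nf k u - Lb.nf k v) u := by
  have hne : v ≠ u := by
    rintro rfl
    exact h.asymm h
  refine ⟨?_, fun w hw hwu => ?_⟩
  · rw [Finsupp.mem_support_iff, repr_nf_sub_nf_apply hne]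
    exact one_ne_zero
  · by_cases hwv : w = v
    · rwa [hwv]
    · rw [Finsupp.mem_support_iff, Lb.repr_nf_sub_nf, Finsupp.sub_apply,
        Finsupp.single_eq_of_ne hwu, Finsupp.single_eq_of_ne hwv] at hw
      exact absurd (sub_zero 0) hw

omit [LinearOrder X] in
theorem wordDeg_one (x : X) (l : List X) : wordDeg (fun _ => 1) ⟨x, l⟩ = l.length + 1 := by
  simp [wordDeg, add_comm]

/-- With all letters of degree 1, equal lengths leave only the lexicographic comparison. -/
theorem degLenLex_of_lt (x y : X) {l l' : List X} (hl : l.length = l'.length) (h : l < l') :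
    DegLenLex (fun _ => 1) ⟨x, y :: l⟩ ⟨x, y :: l'⟩ := by
  refine Or.inr ⟨by simp [wordDeg_one, hl], Or.inr ⟨by simp [FreeSemigroup.length, hl], ?_⟩⟩
  exact List.Lex.cons (List.Lex.cons h)

theorem append_swap_lt (c : List X) {a b : X} (h : b < a) (t : List X) :
    c ++ b :: a :: t < c ++ a :: b :: t :=
  List.append_left_lt (List.cons_lt_cons_iff.2 (Or.inl h))

theorem degLenLex_swap (x y : X) (c : List X) {a b : X} (h : b < a) (t : List X) :
    DegLenLex (fun _ => 1) ⟨x, y :: (c ++ b :: a :: t)⟩ ⟨x, y :: (c ++ a :: b :: t)⟩ :=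
  degLenLex_of_lt x y (by simp) (append_swap_lt c h t)

theorem isLeading_swapPoly (x y : X) (c : List X) {a b : X} (h : b < a) (t : List X) :
    IsLeading (fun _ => 1) (swapPoly k x y c a b t) ⟨x, y :: (c ++ a :: b :: t)⟩ :=
  isLeading_nf_sub_nf (degLenLex_swap x y c h t)

theorem exists_isNormalPoly_swapPoly (x y : X) (c : List X) {a b : X} (h : b < a) (t : List X) :
    ∃ s ∈ metabelianRelations k X, IsNormalPoly (fun _ => 1) s (swapPoly k x y c a b t) :=
  ⟨_, mem_metabelianRelations_iff.2 ⟨x, y, c, a, b, h, rfl⟩,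
    Or.inl ⟨t, (leftNormed_swapPoly x y c a b t).symm⟩⟩

/-- The leading word of a relation has length at least 4, so insertion of the relation after a word
is excluded. -/
theorem IsNormalPoly.eq_swapPoly {x y : X} {c : List X} {a b : X} (hab : b < a) {h : Lb k X}
    (hh : IsNormalPoly (fun _ => 1) (swapPoly k x y c a b []) h) :
    ∃ t, h = swapPoly k x y c a b t := by
  rcases hh with ⟨t, rfl⟩ | ⟨⟨u, hu, hu1⟩, -⟩
  · exact ⟨t, leftNormed_swapPoly x y c a b t⟩
  · rw [hu.unique (isLeading_swapPoly x y c hab [])] at hu1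
    simp [FreeSemigroup.length] at hu1

theorem rearrangements_trivialModDeg {n : ℕ} {f : Lb k X} (hf : f ∈ rearrangements k X n) :
    TrivialModDeg (fun _ => 1) (metabelianRelations k X) n f := by
  refine (Submodule.span_le.2 ?_ : rearrangements k X n ≤ _) hf
  rintro _ ⟨x, y, l, l', h, hn, rfl⟩
  rw [Nat.cast_le] at hn
  refine sub_mem_of_perm (g := fun l => Lb.nf k ⟨x, y :: l⟩) (P := fun l => l.length + 2 ≤ n)
    (fun l l' hl _ h => by rwa [hl.length_eq]) (fun c a b t hab hlen => ?_) h hn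
    (by rwa [← h.length_eq])
  refine Submodule.subset_span ⟨exists_isNormalPoly_swapPoly x y c hab t, _,
    isLeading_swapPoly x y c hab t, ?_⟩
  rw [wordDeg_one]
  exact hlen

theorem nf_sub_nf_trivialModWord (x y : X) {l l' m : List X} (h : l ~ l') (hm : l ~ m)
    (hl : l < m) (hl' : l' < m) :
    TrivialModWord (fun _ => 1) (metabelianRelations k X) ⟨x, y :: m⟩
      (Lb.nf k ⟨x, y :: l⟩ - Lb.nf k ⟨x, y :: l'⟩) := by
  -- The bound `P` says that the word is a rearrangement of `m` below `m`; it applies to the leading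
  -- word of each swap used.
  refine sub_mem_of_perm (g := fun l => Lb.nf k ⟨x, y :: l⟩) (P := fun l => l ~ m ∧ l < m)
    (fun l l' hl hle h => ⟨hl.trans h.1, hle.trans_lt h.2⟩) (fun c a b t hab hc => ?_) h ⟨hm, hl⟩
    ⟨h.symm.trans hm, hl'⟩
  exact Submodule.subset_span ⟨exists_isNormalPoly_swapPoly x y c hab t, _,
    isLeading_swapPoly x y c hab t, degLenLex_of_lt x y hc.1.length_eq hc.2⟩

theorem isGroebnerShirshov_metabelianRelations :
    IsGroebnerShirshov (fun _ => 1) (metabelianRelations k X) where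
  monic s hs := by
    obtain ⟨x, y, c, a, b, hab, rfl⟩ := mem_metabelianRelations_iff.1 hs
    refine ⟨_, isLeading_swapPoly x y c hab [], repr_nf_sub_nf_apply fun e => ?_⟩
    have h := degLenLex_swap x y c hab []
    rw [e] at h
    exact h.asymm h
  inclusion f hf g hg _ h hh u hfu hhu := by
    obtain ⟨x, y, c, a, b, hab, rfl⟩ := mem_metabelianRelations_iff.1 hf
    obtain ⟨x', y', c', a', b', hab', rfl⟩ := mem_metabelianRelations_iff.1 hg
    obtain ⟨t, rfl⟩ := hh.eq_swapPoly hab'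
    obtain rfl := hfu.unique (isLeading_swapPoly x y c hab [])
    have e := hhu.unique (isLeading_swapPoly x' y' c' hab' t)
    rw [FreeSemigroup.mk.injEq, List.cons.injEq] at e
    obtain ⟨rfl, rfl, e⟩ := e
    have p : c ++ [b, a] ~ c ++ [a, b] := (List.Perm.swap a b []).append_left c
    have p' : c' ++ b' :: a' :: t ~ c' ++ a' :: b' :: t := (List.Perm.swap a' b' t).append_left c'
    have l := append_swap_lt c hab []
    have l' := append_swap_lt c' hab' t
    rw [← e] at p' l'
    have key := nf_sub_nf_trivialModWord (k := k) x y (p'.trans p.symm) p' l' l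
    -- The common leading word cancels, leaving two strictly smaller rearrangements of it.
    have e' : swapPoly k x y c a b [] - swapPoly k x y c' a' b' t =
        Lb.nf k ⟨x, y :: (c' ++ b' :: a' :: t)⟩ - Lb.nf k ⟨x, y :: (c ++ [b, a])⟩ := by
      rw [swapPoly, swapPoly, ← e]
      abel
    rw [e']
    exact key
  leftMul f hf u hfu _ v _ := by
    obtain ⟨x, y, c, a, b, hab, rfl⟩ := mem_metabelianRelations_iff.1 hf
    obtain rfl := hfu.unique (isLeading_swapPoly x y c hab [])
    obtain ⟨z, l⟩ := v
    -- The 4 counts `x`, `y`, `a`, `b`, so the index is exactly the degree of the leading word.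
    have h : swapPoly k x y c a b [] ∈ rearrangements k X ((c.length + 4 : ℕ) : ℕ∞) :=
      nf_sub_nf_mem_rearrangements x y ((List.Perm.swap b a []).append_left c) (by simp; rfl)
    have h' := nf_mul_mem_rearrangements z l h
    rw [← Nat.cast_add] at h'
    rw [wordDeg_one, wordDeg_one]
    convert rearrangements_trivialModDeg h' using 2
    simp

end MetabelianGroebnerShirshov

theorem mainTheorem11 (k : Type u) [Field k] (X : Type v) [LinearOrder X] [WellFoundedLT X] :
    IsFreeMetabelianLeibniz.{u, v, max u v, w} k (MLb.of k : X → MLb k X) ∧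
    IsGroebnerShirshov (fun _ => 1) (metabelianRelations k X) ∧
    AlgIdeal.span k (metabelianRelations k X) = metabelianIdeal k X ∧
    ∃ b : Module.Basis {u : FreeSemigroup X // u.tail.tail.IsChain (· ≤ ·)} k (MLb k X),
      ∀ u, b u = leftNormed (MLb.of k u.1.head) (u.1.tail.map (MLb.of k)) :=
  ⟨isFreeMetabelianLeibniz_MLb k X, isGroebnerShirshov_metabelianRelations,
    span_metabelianRelations, MLb.nfBasis k, MLb.nfBasis_apply k⟩
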